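/- **Theorem (Relative completeness of belief Hoare logic).** Let $\mathsf{Var}=\mathsf{Var}_{\mathsf{obs}}\uplus\mathsf{Var}_{\mathsf{inv}}$ be a finite set of observable and invisible variables, $\mathcal A$ a finite set of hypothesis tests, and $\mathsf{IntVar}$ a set of integer variables. For every $y\in\mathsf{Var}_{\mathsf{obs}}$ and $A\in\mathcal A$ there is a history variable $h_{y,A}\in\mathsf{Var}_{\mathsf{inv}}$ of type $\mathbb N$. Data values are Booleans, numbers, real vectors, and pairs, lists and probability distributions of data values; $\bot$ is the undefined value. Each data type is a set of data values. There is a function symbol for every typed function on (possibly undefined) data values, and for each test $A$ a unary symbol $f_A$ denoting its $p$-value, $f_A(y)=\Pr_{r\sim D_A}[\,r\preceq_A t_A(y)\,]$, where $t_A$ is the test statistic, $D_A$ its distribution under the null hypothesis and $\preceq_A$ the likeliness relation. *Programs* are $C::=\mathtt{skip}\mid v:=e\mid C;C\mid C\,\|\,C\mid \mathtt{if}\ e\ \mathtt{then}\ C\ \mathtt{else}\ C\mid\mathtt{loop}\ e\ \mathtt{do}\ C$ with $v$ and all variables of the terms $e$ observable; in every $C_1\|C_2$, no variable assigned by one component occurs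 in the other. A *state* $(m,a,H)$ consists of an assignment $m$ of values to variables, the last action $a$ (a command, or an i.i.d. sampling $d\sim D^n$), and a test history $H$ mapping datasets to multisets of tests; a *world* is a non-empty finite sequence of states, and $(m,a,H)$ denotes its current (last) state. Executing a command appends a state: $\mathtt{skip}$ leaves $m,H$ unchanged; $v:=e$ updates $m$ at $v$; and $v:=f_A(y)$ with $y$ a variable updates $m$ at $v$, increments $h_{y,A}$ by one and adds $A$ to $H(m(y))$. Compound programs have the usual small-step semantics ($\|$ being interleaving), and $[\![C]\!](w)$ is the set of final worlds of the terminating executions of $C$ from $w$. *Formulas* are built by $\neg,\wedge$ and the knowledge modality $\mathbf K$ from the atoms $u=u'$, "$d$ consists of $n$ data sampled from $D$", "$d$ has been sampled from $D$", and "$\varepsilon\in[0,1]$ and the $p$-value of $A$ on $y$ is $\bowtie\varepsilon$" ($\bowtie\,\in\{=,\le,\ge,<,>\}$), on terms built from all variables, integer variables and function symbols; outside $\mathbf K$, formulas may also use $\neg,\wedge$ and $\forall i$, with $i\in\mathsf{IntVar}$ ranging over finite tuples of integers. A *model* is a non-empty set of worlds, closed under prefixes and under executing commands, in which every non-initial state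 arises from its predecessor by its recorded action (a sampling changing neither $H$ nor any $h_{y,A}$), and in initial states $H$ is empty and all $h_{y,A}=0$. $\mathbf K\varphi$ holds in $w$ iff $\varphi$ holds in all worlds of the model with the same observation as $w$, i.e. equal to $w$ up to the values of the invisible variables. An *environment* $\Gamma$ assigns types to the variables. $\Gamma\models\varphi$ means that $\varphi$ holds, under every interpretation of the integer variables, in every world of every model whose current assignment respects $\Gamma$. The judgment $\Gamma\vdash\{\psi\}\,C\,\{\varphi\}$ is *valid* if for every model, every interpretation of the integer variables and every world $w$ that respects $\Gamma$ and satisfies $\psi$, all $w'\in[\![C]\!](w)$ satisfy $\varphi$. It is *derivable* if it is obtained from the following axioms and rules, in which a Boolean term $e$ used as a formula stands for $e=\mathtt{true}$: - (Skip) $\{\psi\}\,\mathtt{skip}\,\{\psi\}$; - (UpdVar) $\{\varphi[v\mapsto e]\}\,v:=e\,\{\varphi\}$ if $\Gamma(v)=\Gamma(e)$ and $e$ is not of the form $f_A(y)$ with $y$ a variable; - (Hist) $\{\varphi[v\mapsto f_A(y),\,h_{y,A}\mapsto h_{y,A}+1]\}\,v:=f_A(y)\,\{\varphi\}$ if $\Gamma(v)=[0,1]$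 and $\Gamma(y)$ is the type of the datasets of $A$; - (Seq) from $\{\psi\}C_1\{\chi\}$ and $\{\chi\}C_2\{\varphi\}$ infer $\{\psi\}C_1;C_2\{\varphi\}$; - (If) from $\{\psi\wedge e\}C_1\{\varphi\}$ and $\{\psi\wedge\neg e\}C_2\{\varphi\}$ infer $\{\psi\}\,\mathtt{if}\ e\ \mathtt{then}\ C_1\ \mathtt{else}\ C_2\,\{\varphi\}$; - (Loop) from $\{\psi\wedge e\}C\{\psi\}$ infer $\{\psi\}\,\mathtt{loop}\ e\ \mathtt{do}\ C\,\{\psi\wedge\neg e\}$; - (Par) from $\{\psi\}C_1;C_2\{\varphi\}$ infer $\{\psi\}C_1\|C_2\{\varphi\}$, for $C_1\|C_2$ as restricted above; - (Conseq) from $\Gamma\models\psi\to\psi'$, $\{\psi'\}C\{\varphi'\}$ and $\Gamma\models\varphi'\to\varphi$ infer $\{\psi\}C\{\varphi\}$. Then for every environment $\Gamma$, every program $C$ that is well-typed under $\Gamma$, and all formulas $\psi,\varphi$: if $\Gamma\vdash\{\psi\}\,C\,\{\varphi\}$ is valid, then it is derivable. -/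

import Mathlib

open MeasureTheory

noncomputable section

namespace BHL

/-! ## Data values and types -/

/-- The sorts of data values.  Integers, natural numbers and probabilities are numbers, hence
they are elements of the sort `num` of real numbers; they are singled out by types below. -/
inductive Shape : Type
  | bool
  | num
  | vec (l : ℕ)
  | prod (s t : Shape)
  | list (s : Shape)
  | dist (s : Shape)

/-- Lists carry the sigma-algebra of the disjoint union of the finite powers. -/
abbrev listMeasurableSpace (α : Type) [MeasurableSpace α] : MeasurableSpace (List α) :=
  MeasurableSpace.map (fun p : (Σ n : ℕ, (Fin n → α)) => List.ofFn p.2) inferInstance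

/-- The measurable space of data values of a given sort: Booleans, reals, vectors in `ℝ^l`, pairs,
lists, and probability distributions. -/
def Shape.space : Shape → MeasCat.{0}
  | .bool => MeasCat.of Bool
  | .num => MeasCat.of ℝ
  | .vec l => MeasCat.of (Fin l → ℝ)
  | .prod s t => MeasCat.of (s.space.carrier × t.space.carrier)
  | .list s => @MeasCat.of (List s.space.carrier) (listMeasurableSpace s.space.carrier)
  | .dist s => MeasCat.of (ProbabilityMeasure s.space.carrier)

/-- The set of data values of a given sort. -/
abbrev Shape.Carrier (s : Shape) : Type := s.space.carrier

/-- The set of all data values.  `Option Value` adds the undefined value (`none`). -/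
abbrev Value : Type := Σ s : Shape, s.Carrier

/-- The data value given by a Boolean. -/
def Value.bool (b : Bool) : Value := ⟨.bool, b⟩

/-- The data value given by a number. -/
def Value.num (x : ℝ) : Value := ⟨.num, x⟩

/-- The data value given by a finite tuple of integers. -/
def Value.intTuple (z : List ℤ) : Value := ⟨.list .num, z.map (fun k : ℤ => (k : ℝ))⟩

/-- Types; `prob` is the type of the elements of `[0, 1]`. -/
inductive Ty : Type
  | bool
  | nat
  | int
  | real
  | prob
  | vec (l : ℕ)
  | prod (a b : Ty)
  | list (a : Ty)
  | dist (a : Ty)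

/-- The sort of the values of a type. -/
def Ty.shape : Ty → Shape
  | .bool => .bool
  | .nat => .num
  | .int => .num
  | .real => .num
  | .prob => .num
  | .vec l => .vec l
  | .prod a b => .prod a.shape b.shape
  | .list a => .list a.shape
  | .dist a => .dist a.shape

/-- The values of a type among the values of its sort. -/
def Ty.Mem : (a : Ty) → a.shape.Carrier → Prop
  | .bool, _ => True
  | .nat, x => ∃ n : ℕ, @Eq ℝ x (n : ℝ)
  | .int, x => ∃ n : ℤ, @Eq ℝ x (n : ℝ)
  | .real, _ => True
  | .prob, x => @LE.le ℝ _ 0 x ∧ @LE.le ℝ _ x 1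
  | .vec _, _ => True
  | .prod a b, p => a.Mem (Prod.fst (α := a.shape.Carrier) (β := b.shape.Carrier) p) ∧
      b.Mem (Prod.snd (α := a.shape.Carrier) (β := b.shape.Carrier) p)
  | .list a, l => ∀ x, List.Mem (α := a.shape.Carrier) x l → a.Mem x
  | .dist a, μ => ∀ᵐ x ∂(ProbabilityMeasure.toMeasure (Ω := a.shape.Carrier) μ), a.Mem x

/-- `o` is a (defined) value of type `a`. -/
def HasTy (o : Option Value) (a : Ty) : Prop :=
  ∃ x : a.shape.Carrier, o = some ⟨a.shape, x⟩ ∧ a.Mem x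

/-! ## Vocabulary, terms, commands and programs -/

/-- The names in use: the finite sets of observable variables, of invisible variables other than
the history variables, and of hypothesis tests, and the set of integer variables. -/
structure Vocab : Type 1 where
  Obs : Type
  Par : Type
  Test : Type
  IVar : Type
  [finObs : Finite Obs]
  [finPar : Finite Par]
  [finTest : Finite Test]

/-- Variables: observable ones, and the invisible ones, among which there is a history variable
`hist y A` for every observable variable `y` and every test `A`. -/
inductive Var (V : Vocab) : Type
  | obs (v : V.Obs)
  | hist (y : V.Obs) (A : V.Test)
  | par (x : V.Par)

/-- Function symbols (other than the symbols `f_A` of the hypothesis tests).  There is a symbol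
for every function on (possibly undefined) data values, together with a type that it has;
constants are the symbols of arity `0`. -/
structure Fun : Type where
  arity : ℕ
  dom : Fin arity → Ty
  cod : Ty
  fn : (Fin arity → Option Value) → Option Value
  typed : ∀ a, (∀ i, HasTy (a i) (dom i)) → HasTy (fn a) cod

/-- The constant `true`. -/
def Fun.tt : Fun where
  arity := 0
  dom := Fin.elim0
  cod := .bool
  fn := fun _ => some (Value.bool true)
  typed := fun _ _ => ⟨true, rfl, trivial⟩

/-- The successor function on numbers. -/
def succVal : Option Value → Option Value
  | some ⟨.num, x⟩ => some (Value.num (@id ℝ x + 1))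
  | _ => none

/-- The function symbol for `n ↦ n + 1`. -/
def Fun.succ : Fun where
  arity := 1
  dom := fun _ => .nat
  cod := .nat
  fn := fun a => succVal (a 0)
  typed := by
    intro a h
    obtain ⟨x, hx, n, hn⟩ := h 0
    refine ⟨@id ℝ x + 1, ?_, n + 1, ?_⟩
    · rw [hx]; rfl
    · have hn' : (@id ℝ x) = n := hn
      rw [hn']; push_cast; rfl

/-- Program terms: observable variables and applications of function symbols, the last
constructor being the application of the symbol `f_A` of a hypothesis test `A`. -/
inductive PTerm (V : Vocab) : Type
  | var (v : V.Obs)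
  | app (f : Fun) (args : Fin f.arity → PTerm V)
  | pval (A : V.Test) (e : PTerm V)

/-- Recognizes the terms of the form `f_A(y)` with `y` a variable. -/
def PTerm.testCall {V : Vocab} : PTerm V → Option (V.Obs × V.Test)
  | .pval A (.var y) => some (y, A)
  | _ => none

/-- The variables of a program term. -/
def PTerm.vars {V : Vocab} : PTerm V → Set V.Obs
  | .var v => {v}
  | .app _ args => ⋃ i, (args i).vars
  | .pval _ e => e.vars

/-- Commands: `skip` and assignments `v := e`.  The command that performs the test `A` on `y` is
the assignment `v := f_A(y)`. -/
inductive Cmd (V : Vocab) : Type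
  | skip
  | assign (v : V.Obs) (e : PTerm V)

/-- Programs. -/
inductive Prog (V : Vocab) : Type
  | cmd (c : Cmd V)
  | seq (C₁ C₂ : Prog V)
  | par (C₁ C₂ : Prog V)
  | ite (e : PTerm V) (C₁ C₂ : Prog V)
  | loop (e : PTerm V) (C : Prog V)

/-- The variables that may be updated by a program. -/
def Prog.upd {V : Vocab} : Prog V → Set V.Obs
  | .cmd .skip => ∅
  | .cmd (.assign v _) => {v}
  | .seq C₁ C₂ => C₁.upd ∪ C₂.upd
  | .par C₁ C₂ => C₁.upd ∪ C₂.upd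
  | .ite _ C₁ C₂ => C₁.upd ∪ C₂.upd
  | .loop _ C => C.upd

/-- The variables occurring in a program. -/
def Prog.vars {V : Vocab} : Prog V → Set V.Obs
  | .cmd .skip => ∅
  | .cmd (.assign v e) => {v} ∪ e.vars
  | .seq C₁ C₂ => C₁.vars ∪ C₂.vars
  | .par C₁ C₂ => C₁.vars ∪ C₂.vars
  | .ite e C₁ C₂ => e.vars ∪ (C₁.vars ∪ C₂.vars)
  | .loop e C => e.vars ∪ C.vars

/-- The two components of a parallel composition do not interfere. -/
def NonInterfering {V : Vocab} (C₁ C₂ : Prog V) : Prop :=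
  C₁.upd ∩ C₂.vars = ∅ ∧ C₂.upd ∩ C₁.vars = ∅

/-- The syntactic restriction on programs: every parallel composition occurring in the program is
non-interfering. -/
def Prog.WellFormed {V : Vocab} : Prog V → Prop
  | .cmd _ => True
  | .seq C₁ C₂ => C₁.WellFormed ∧ C₂.WellFormed
  | .par C₁ C₂ => NonInterfering C₁ C₂ ∧ C₁.WellFormed ∧ C₂.WellFormed
  | .ite _ C₁ C₂ => C₁.WellFormed ∧ C₂.WellFormed
  | .loop _ C => C.WellFormed

/-! ## The assertion language -/

/-- Assertion terms. -/
inductive ATerm (V : Vocab) : Type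
  | var (x : Var V)
  | ivar (i : V.IVar)
  | app (f : Fun) (args : Fin f.arity → ATerm V)
  | pval (A : V.Test) (u : ATerm V)

/-- The comparison symbols `=, ≤, ≥, <, >`. -/
inductive Cmp : Type
  | eq | le | ge | lt | gt

/-- The relation on real numbers denoted by a comparison symbol. -/
def Cmp.Rel : Cmp → ℝ → ℝ → Prop
  | .eq, a, b => a = b
  | .le, a, b => a ≤ b
  | .ge, a, b => b ≤ a
  | .lt, a, b => a < b
  | .gt, a, b => b < a

/-- Atomic formulas: equality; `sampled d D n` (the dataset `d` consists of `n` data sampled from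
the population `D`); `followed d D` (the dataset `d` has been sampled from the population `D`);
`unlikely A b y ε` (the `p`-value of the test `A` on the dataset `y` is in relation `b` to `ε`). -/
inductive Atom (V : Vocab) : Type
  | eq (u u' : ATerm V)
  | sampled (d D n : ATerm V)
  | followed (d D : ATerm V)
  | unlikely (A : V.Test) (b : Cmp) (y ε : ATerm V)

/-- Quantifier-free formulas with the knowledge modality. -/
inductive MForm (V : Vocab) : Type
  | atom (a : Atom V)
  | neg (φ : MForm V)
  | and (φ ψ : MForm V)
  | know (φ : MForm V)

/-- Formulas; quantifiers over integer variables never occur inside the knowledge modality. -/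
inductive Form (V : Vocab) : Type
  | base (φ : MForm V)
  | neg (φ : Form V)
  | and (φ ψ : Form V)
  | all (i : V.IVar) (φ : Form V)

/-- Implication, as syntax sugar. -/
def Form.imp {V : Vocab} (φ ψ : Form V) : Form V := .neg (.and φ (.neg ψ))

/-- Program terms as assertion terms. -/
def PTerm.toATerm {V : Vocab} : PTerm V → ATerm V
  | .var v => .var (.obs v)
  | .app f args => .app f (fun i => (args i).toATerm)
  | .pval A e => .pval A e.toATerm

/-- A Boolean program term `e` as the assertion `e = true`. -/
def PTerm.toForm {V : Vocab} (e : PTerm V) : Form V :=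
  .base (.atom (.eq e.toATerm (.app Fun.tt Fin.elim0)))

/-- Simultaneous substitution of assertion terms for the (observable and invisible) variables. -/
def ATerm.subst {V : Vocab} (σ : Var V → ATerm V) : ATerm V → ATerm V
  | .var x => σ x
  | .ivar i => .ivar i
  | .app f args => .app f (fun k => (args k).subst σ)
  | .pval A u => .pval A (u.subst σ)

/-- Substitution in atomic formulas. -/
def Atom.subst {V : Vocab} (σ : Var V → ATerm V) : Atom V → Atom V
  | .eq u u' => .eq (u.subst σ) (u'.subst σ)
  | .sampled d D n => .sampled (d.subst σ) (D.subst σ) (n.subst σ)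
  | .followed d D => .followed (d.subst σ) (D.subst σ)
  | .unlikely A b y ε => .unlikely A b (y.subst σ) (ε.subst σ)

/-- Substitution in quantifier-free formulas. -/
def MForm.subst {V : Vocab} (σ : Var V → ATerm V) : MForm V → MForm V
  | .atom a => .atom (a.subst σ)
  | .neg φ => .neg (φ.subst σ)
  | .and φ ψ => .and (φ.subst σ) (ψ.subst σ)
  | .know φ => .know (φ.subst σ)

/-- Substitution in formulas.  It is used only for terms without integer variables, so that no
variable is captured by a quantifier. -/
def Form.subst {V : Vocab} (σ : Var V → ATerm V) : Form V → Form V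
  | .base φ => .base (φ.subst σ)
  | .neg φ => .neg (φ.subst σ)
  | .and φ ψ => .and (φ.subst σ) (ψ.subst σ)
  | .all i φ => .all i (φ.subst σ)

open Classical in
/-- The substitution `[v ↦ e]`. -/
def assignSubst {V : Vocab} (v : V.Obs) (e : PTerm V) : Var V → ATerm V :=
  Function.update ATerm.var (.obs v) e.toATerm

open Classical in
/-- The substitution `[v ↦ f_A(y), h_{y,A} ↦ h_{y,A} + 1]`. -/
def testSubst {V : Vocab} (v y : V.Obs) (A : V.Test) : Var V → ATerm V :=
  Function.update (assignSubst v (.pval A (.var y))) (.hist y A)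
    (.app Fun.succ (fun _ => .var (.hist y A)))

/-! ## Hypothesis tests -/

/-- A hypothesis test: its null hypothesis, the type of its datasets (such as lists of vectors),
its test statistic, the distribution of the test statistic under the null hypothesis, its
likeliness relation (`likeliness r r'` says that `r` is at most as likely as `r'`), and a term
denoting the population of its statistical model. -/
structure HypTest (V : Vocab) : Type 1 where
  null : Form V
  dataTy : Ty
  Range : Type
  [meas : MeasurableSpace Range]
  stat : dataTy.shape.Carrier → Range
  law : ProbabilityMeasure Range
  likeliness : Range → Range → Prop
  measurable_likeliness : ∀ r', MeasurableSet {r | likeliness r r'}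
  population : ATerm V

attribute [instance] HypTest.meas

/-- The `p`-value of a test on a dataset. -/
def HypTest.pValue {V : Vocab} (A : HypTest V) (d : A.dataTy.shape.Carrier) : ℝ :=
  (A.law.toMeasure {r | A.likeliness r (A.stat d)}).toReal

open Classical in
/-- The interpretation of the symbol `f_A`: the `p`-value, undefined outside the datasets. -/
def HypTest.pVal {V : Vocab} (A : HypTest V) : Option Value → Option Value
  | some ⟨s, x⟩ =>
      if h : s = A.dataTy.shape then some (Value.num (A.pValue (h ▸ x))) else none
  | none => none

/-- A hypothesis test for every name of a test. -/
abbrev Tests (V : Vocab) : Type 1 := V.Test → HypTest V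

/-! ## States, possible worlds, execution of commands -/

/-- An i.i.d. sampling of a finite dataset of vectors in `ℝ^dim` from a population. -/
structure Sampling : Type where
  dim : ℕ
  data : List (Fin dim → ℝ)
  popl : ProbabilityMeasure (Fin dim → ℝ)

/-- The sampled dataset as a data value. -/
def Sampling.dataVal (a : Sampling) : Value := ⟨.list (.vec a.dim), a.data⟩

/-- The population as a data value. -/
def Sampling.poplVal (a : Sampling) : Value := ⟨.dist (.vec a.dim), a.popl⟩

/-- The number of data as a data value. -/
def Sampling.sizeVal (a : Sampling) : Value := Value.num (a.data.length : ℝ)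

/-- Actions. -/
inductive Act (V : Vocab) : Type
  | smpl (a : Sampling)
  | cmd (c : Cmd V)

/-- Assignments of values to the variables. -/
abbrev Mem (V : Vocab) : Type := Var V → Option Value

/-- States: an assignment, the last action, and a test history. -/
structure State (V : Vocab) : Type where
  mem : Mem V
  act : Act V
  hist : Value → Multiset V.Test

/-- Possible worlds: non-empty finite sequences of states. -/
inductive World (V : Vocab) : Type
  | start (s : State V)
  | snoc (w : World V) (s : State V)

/-- The current state of a world. -/
def World.cur {V : Vocab} : World V → State V
  | .start s => s
  | .snoc _ s => s

/-- The observation of a state: the values of the invisible variables are hidden. -/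
def State.observe {V : Vocab} (s : State V) : State V where
  mem := fun x => match x with
    | .obs v => s.mem (.obs v)
    | _ => none
  act := s.act
  hist := s.hist

/-- The observation of a world. -/
def World.observe {V : Vocab} : World V → World V
  | .start s => .start s.observe
  | .snoc w s => .snoc w.observe s.observe

/-- The value of a program term. -/
def PTerm.eval {V : Vocab} (T : Tests V) (m : Mem V) : PTerm V → Option Value
  | .var v => m (.obs v)
  | .app f args => f.fn (fun i => (args i).eval T m)
  | .pval A e => (T A).pVal (e.eval T m)

open Classical in
/-- The state after executing a command.  An assignment `v := f_A(y)` also increments the history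
variable `h_{y,A}` and adds `A` to the history at the dataset `m(y)`. -/
def Cmd.next {V : Vocab} (T : Tests V) (c : Cmd V) (s : State V) : State V :=
  match c with
  | .skip => ⟨s.mem, .cmd c, s.hist⟩
  | .assign v e =>
    match e.testCall with
    | none => ⟨Function.update s.mem (.obs v) (e.eval T s.mem), .cmd c, s.hist⟩
    | some (y, A) =>
      ⟨Function.update (Function.update s.mem (.obs v) (e.eval T s.mem))
          (.hist y A) (succVal (s.mem (.hist y A))),
        .cmd c,
        fun o => if s.mem (.obs y) = some o then s.hist o + {A} else s.hist o⟩

/-- The world after executing a command. -/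
def Cmd.exec {V : Vocab} (T : Tests V) (c : Cmd V) (w : World V) : World V :=
  w.snoc (c.next T w.cur)

/-! ## Operational semantics of programs -/

/-- Configurations: a program to be run in a world, or the final world. -/
inductive Config (V : Vocab) : Type
  | run (C : Prog V) (w : World V)
  | done (w : World V)

/-- One step of execution. -/
inductive Step {V : Vocab} (T : Tests V) : Config V → Config V → Prop
  | cmd (c w) : Step T (.run (.cmd c) w) (.done (c.exec T w))
  | seq_done {C₁ w w'} (C₂) : Step T (.run C₁ w) (.done w') →
      Step T (.run (.seq C₁ C₂) w) (.run C₂ w')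
  | seq_run {C₁ C₁' w w'} (C₂) : Step T (.run C₁ w) (.run C₁' w') →
      Step T (.run (.seq C₁ C₂) w) (.run (.seq C₁' C₂) w')
  | ite_true {e w} (C₁ C₂) : e.eval T w.cur.mem = some (Value.bool true) →
      Step T (.run (.ite e C₁ C₂) w) (.run C₁ w)
  | ite_false {e w} (C₁ C₂) : e.eval T w.cur.mem = some (Value.bool false) →
      Step T (.run (.ite e C₁ C₂) w) (.run C₂ w)
  | loop_true {e w} (C) : e.eval T w.cur.mem = some (Value.bool true) →
      Step T (.run (.loop e C) w) (.run (.seq C (.loop e C)) w)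
  | loop_false {e w} (C) : e.eval T w.cur.mem = some (Value.bool false) →
      Step T (.run (.loop e C) w) (.done w)
  | par_left_run {C₁ C₁' w w'} (C₂) : Step T (.run C₁ w) (.run C₁' w') →
      Step T (.run (.par C₁ C₂) w) (.run (.par C₁' C₂) w')
  | par_left_done {C₁ w w'} (C₂) : Step T (.run C₁ w) (.done w') →
      Step T (.run (.par C₁ C₂) w) (.run C₂ w')
  | par_right_run {C₂ C₂' w w'} (C₁) : Step T (.run C₂ w) (.run C₂' w') →
      Step T (.run (.par C₁ C₂) w) (.run (.par C₁ C₂') w')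
  | par_right_done {C₂ w w'} (C₁) : Step T (.run C₂ w) (.done w') →
      Step T (.run (.par C₁ C₂) w) (.run C₁ w')

/-- The semantic relation of a program: the final worlds of its terminating executions from `w`. -/
def Prog.sem {V : Vocab} (T : Tests V) (C : Prog V) (w : World V) : Set (World V) :=
  {w' | Relation.ReflTransGen (Step T) (.run C w) (.done w')}

/-! ## Kripke models and semantics of assertions -/

/-- The effect of an action on a state.  A command acts by its semantics; a sampling may assign new
values to variables, but it executes no test, so that it changes neither the test history nor the
history variables. -/
def Act.Trans {V : Vocab} (T : Tests V) : Act V → State V → State V → Prop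
  | .cmd c, s, s' => s' = c.next T s
  | .smpl a, s, s' => s'.act = .smpl a ∧ s'.hist = s.hist ∧
      ∀ y A, s'.mem (.hist y A) = s.mem (.hist y A)

/-- Kripke models: a non-empty set of possible worlds in which every state but the first arises
from the preceding ones by the action that it records, no test has been performed at initial
states, and every command can be executed in every world.  The transition relations, the
observability relation and the valuation are determined by the set of worlds and defined below. -/
structure Model {V : Vocab} (T : Tests V) : Type where
  worlds : Set (World V)
  nonempty : worlds.Nonempty
  start_hist : ∀ s, World.start s ∈ worlds → ∀ o, s.hist o = 0
  start_histVar : ∀ s, World.start s ∈ worlds →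
    ∀ y A, s.mem (.hist y A) = some (Value.num 0)
  prefix_mem : ∀ w s, World.snoc w s ∈ worlds → w ∈ worlds
  trans : ∀ w s, World.snoc w s ∈ worlds → s.act.Trans T w.cur s
  closed : ∀ w ∈ worlds, ∀ c : Cmd V, c.exec T w ∈ worlds

/-- The sampling `a` has been performed in the course of the world. -/
def World.HasSampled {V : Vocab} (a : Sampling) : World V → Prop
  | .start _ => False
  | .snoc w s => w.HasSampled a ∨ s.act = .smpl a

/-- The value of an assertion term, for an interpretation `I` of the integer variables by finite
tuples of integers. -/
def ATerm.eval {V : Vocab} (T : Tests V) (I : V.IVar → List ℤ) (m : Mem V) :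
    ATerm V → Option Value
  | .var x => m x
  | .ivar i => some (Value.intTuple (I i))
  | .app f args => f.fn (fun k => (args k).eval T I m)
  | .pval A u => (T A).pVal (u.eval T I m)

/-- Truth of atomic formulas in a world. -/
def Atom.Sat {V : Vocab} (T : Tests V) (I : V.IVar → List ℤ) (w : World V) : Atom V → Prop
  | .eq u u' => ∃ o : Value, u.eval T I w.cur.mem = some o ∧ u'.eval T I w.cur.mem = some o
  | .sampled d D n => ∃ a : Sampling, w.HasSampled a ∧
      d.eval T I w.cur.mem = some a.dataVal ∧ D.eval T I w.cur.mem = some a.poplVal ∧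
      n.eval T I w.cur.mem = some a.sizeVal
  | .followed d D => ∃ a : Sampling, w.HasSampled a ∧
      d.eval T I w.cur.mem = some a.dataVal ∧ D.eval T I w.cur.mem = some a.poplVal
  | .unlikely A b y ε => ∃ p e : ℝ, (T A).pVal (y.eval T I w.cur.mem) = some (Value.num p) ∧
      ε.eval T I w.cur.mem = some (Value.num e) ∧ 0 ≤ e ∧ e ≤ 1 ∧ b.Rel p e

/-- Truth of quantifier-free formulas in a world of a model; two worlds are related if they have
the same observation. -/
def MForm.Sat {V : Vocab} {T : Tests V} (M : Model T) (I : V.IVar → List ℤ) :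
    MForm V → World V → Prop
  | .atom a, w => a.Sat T I w
  | .neg φ, w => ¬ φ.Sat M I w
  | .and φ ψ, w => φ.Sat M I w ∧ ψ.Sat M I w
  | .know φ, w => ∀ w' ∈ M.worlds, w.observe = w'.observe → φ.Sat M I w'

open Classical in
/-- Truth of formulas in a world of a model. -/
def Form.Sat {V : Vocab} {T : Tests V} (M : Model T) :
    Form V → (V.IVar → List ℤ) → World V → Prop
  | .base φ, I, w => φ.Sat M I w
  | .neg φ, I, w => ¬ φ.Sat M I w
  | .and φ ψ, I, w => φ.Sat M I w ∧ ψ.Sat M I w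
  | .all i φ, I, w => ∀ n : List ℤ, φ.Sat M (Function.update I i n) w

/-! ## Environments, judgments, derivations -/

/-- Environments: types for the observable and the invisible variables; history variables have the
type of natural numbers. -/
structure Env (V : Vocab) : Type where
  obs : V.Obs → Ty
  par : V.Par → Ty

/-- The type of a variable. -/
def Env.ty {V : Vocab} (Γ : Env V) : Var V → Ty
  | .obs v => Γ.obs v
  | .hist _ _ => .nat
  | .par x => Γ.par x

/-- The world respects the type information of the environment. -/
def Env.Respects {V : Vocab} (Γ : Env V) (w : World V) : Prop :=
  ∀ x : Var V, HasTy (w.cur.mem x) (Γ.ty x)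

/-- `e` is well-typed, of type `a`. -/
inductive PTerm.Typed {V : Vocab} (T : Tests V) (Γ : Env V) : PTerm V → Ty → Prop
  | var (v) : Typed T Γ (.var v) (Γ.obs v)
  | app (f args) : (∀ i, Typed T Γ (args i) (f.dom i)) → Typed T Γ (.app f args) f.cod
  | pval {A e} : Typed T Γ e (T A).dataTy → Typed T Γ (.pval A e) .prob

/-- Well-typed programs. -/
def Prog.WellTyped {V : Vocab} (T : Tests V) (Γ : Env V) : Prog V → Prop
  | .cmd .skip => True
  | .cmd (.assign v e) => e.Typed T Γ (Γ.obs v)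
  | .seq C₁ C₂ => C₁.WellTyped T Γ ∧ C₂.WellTyped T Γ
  | .par C₁ C₂ => C₁.WellTyped T Γ ∧ C₂.WellTyped T Γ
  | .ite e C₁ C₂ => e.Typed T Γ .bool ∧ C₁.WellTyped T Γ ∧ C₂.WellTyped T Γ
  | .loop e C => e.Typed T Γ .bool ∧ C.WellTyped T Γ

/-- `Γ ⊨ φ`: the formula holds in all worlds of all models that respect `Γ`. -/
def Env.Entails {V : Vocab} (T : Tests V) (Γ : Env V) (φ : Form V) : Prop :=
  ∀ (M : Model T) (I : V.IVar → List ℤ), ∀ w ∈ M.worlds, Γ.Respects w → φ.Sat M I w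

/-- Validity of the judgment `Γ ⊢ {ψ} C {φ}` (partial correctness). -/
def Valid {V : Vocab} (T : Tests V) (Γ : Env V) (ψ : Form V) (C : Prog V) (φ : Form V) : Prop :=
  ∀ (M : Model T) (I : V.IVar → List ℤ), ∀ w ∈ M.worlds, Γ.Respects w →
    ψ.Sat M I w → ∀ w' ∈ C.sem T w, φ.Sat M I w'

/-- Derivability of judgments in belief Hoare logic. -/
inductive Derivable {V : Vocab} (T : Tests V) (Γ : Env V) : Form V → Prog V → Form V → Prop
  | skip (ψ) : Derivable T Γ ψ (.cmd .skip) ψ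
  | updVar {v e} (φ) : e.testCall = none → e.Typed T Γ (Γ.obs v) →
      Derivable T Γ (φ.subst (assignSubst v e)) (.cmd (.assign v e)) φ
  | hist {v y A} (φ) : Γ.obs y = (T A).dataTy → Γ.obs v = .prob →
      Derivable T Γ (φ.subst (testSubst v y A)) (.cmd (.assign v (.pval A (.var y)))) φ
  | seq {ψ χ φ C₁ C₂} : Derivable T Γ ψ C₁ χ → Derivable T Γ χ C₂ φ →
      Derivable T Γ ψ (.seq C₁ C₂) φ
  | ite {ψ φ e C₁ C₂} : Derivable T Γ (.and ψ e.toForm) C₁ φ →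
      Derivable T Γ (.and ψ (.neg e.toForm)) C₂ φ → Derivable T Γ ψ (.ite e C₁ C₂) φ
  | loop {ψ e C} : Derivable T Γ (.and ψ e.toForm) C ψ →
      Derivable T Γ ψ (.loop e C) (.and ψ (.neg e.toForm))
  | par {ψ φ C₁ C₂} : NonInterfering C₁ C₂ → Derivable T Γ ψ (.seq C₁ C₂) φ →
      Derivable T Γ ψ (.par C₁ C₂) φ
  | conseq {ψ ψ' φ φ' C} : Γ.Entails T (ψ.imp ψ') → Derivable T Γ ψ' C φ' →
      Γ.Entails T (φ'.imp φ) → Derivable T Γ ψ C φ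

end BHL

end

namespace BHL

variable {V : Vocab} {T : Tests V} {Γ : Env V}

/-! The heart of the matter is that weakest preconditions are expressible; as in Cook's argument for
ordinary Hoare logic, they then serve as intermediate assertions for sequencing and as loop
invariants. No arithmetical coding of computations is needed: there is a symbol for every typed
function and only finitely many variables, so a single symbol applied to all variables can denote
the final value of a variable, or tell whether the program terminates (`Env.exists_term`). The
weakest precondition of `φ` is "if the run terminates, then `φ` with every variable replaced by its
final value" (`Env.exists_wp`).

Such a replacement must also be sound under the knowledge modality. Guards and assigned terms read
observable variables only, so indistinguishable worlds execute the same list of commands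
(`Runs.congr`) and remain indistinguishable. Conversely, observations retain the recorded actions
and models are closed under prefixes, so every world that looks like the outcome of these commands
is their outcome from some world indistinguishable from the initial one
(`Model.exists_execList_eq`). Hence knowledge commutes with the substitution (`MForm.sat_subst`).

Parallel compositions are run from left to right, which makes programs deterministic. This is one of
the interleavings, so validity passes to these runs (`Runs.mem_sem`), and the rule for parallel
composition asks for nothing more. The derivation is then found by induction on the program
(`SeqValid.derivable`). -/

/-! ## Memories and traces of commands -/

/-- The memory after executing a command. -/
noncomputable def Cmd.nextMem (T : Tests V) (c : Cmd V) (m : Mem V) : Mem V :=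
  -- The action and the history are placeholders: the new memory depends on the old memory alone.
  (c.next T ⟨m, .cmd c, fun _ => 0⟩).mem

theorem Cmd.next_mem (c : Cmd V) (s : State V) : (c.next T s).mem = c.nextMem T s.mem := by
  cases c with
  | skip => rfl
  | assign v e => rcases h : e.testCall with _ | ⟨y, A⟩ <;> simp [Cmd.nextMem, Cmd.next, h]

theorem Cmd.next_act (c : Cmd V) (s : State V) : (c.next T s).act = .cmd c := by
  cases c with
  | skip => rfl
  | assign v e => rcases h : e.testCall with _ | ⟨y, A⟩ <;> simp [Cmd.next, h]

/-- The memory after executing a list of commands. -/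
noncomputable def memAfter (T : Tests V) : List (Cmd V) → Mem V → Mem V
  | [], m => m
  | c :: cs, m => memAfter T cs (c.nextMem T m)

/-- The world after executing a list of commands. -/
noncomputable def execList (T : Tests V) : List (Cmd V) → World V → World V
  | [], w => w
  | c :: cs, w => execList T cs (c.exec T w)

theorem memAfter_append (cs ds : List (Cmd V)) (m : Mem V) :
    memAfter T (cs ++ ds) m = memAfter T ds (memAfter T cs m) := by
  induction cs generalizing m with
  | nil => rfl
  | cons c cs ih => exact ih _

theorem execList_append (cs ds : List (Cmd V)) (w : World V) :
    execList T (cs ++ ds) w = execList T ds (execList T cs w) := by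
  induction cs generalizing w with
  | nil => rfl
  | cons c cs ih => exact ih _

theorem execList_cur_mem (cs : List (Cmd V)) (w : World V) :
    (execList T cs w).cur.mem = memAfter T cs w.cur.mem := by
  induction cs generalizing w with
  | nil => rfl
  | cons c cs ih =>
    rw [execList, ih, memAfter, ← Cmd.next_mem]
    rfl

theorem execList_mem_worlds (M : Model T) (cs : List (Cmd V)) {w : World V}
    (hw : w ∈ M.worlds) : execList T cs w ∈ M.worlds := by
  induction cs generalizing w with
  | nil => exact hw
  | cons c cs ih => exact ih (M.closed _ hw c)

/-- Commands record only command actions, so the atoms about sampling refer to the same samplings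
before and after execution. -/
theorem hasSampled_execList (a : Sampling) (cs : List (Cmd V)) (w : World V) :
    (execList T cs w).HasSampled a ↔ w.HasSampled a := by
  induction cs generalizing w with
  | nil => rfl
  | cons c cs ih =>
    rw [execList, ih]
    simp [Cmd.exec, World.HasSampled, Cmd.next_act]

/-! ## Observations -/

/-- The memories agree on the observable variables. -/
def AgreeObs (m m' : Mem V) : Prop := ∀ v, m (.obs v) = m' (.obs v)

theorem PTerm.eval_congr {m m' : Mem V} (h : AgreeObs m m') (e : PTerm V) :
    e.eval T m = e.eval T m' := by
  induction e with
  | var v => exact h v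
  | app f args ih => simp only [PTerm.eval, ih]
  | pval A e ih => simp only [PTerm.eval, ih]

theorem AgreeObs.nextMem {m m' : Mem V} (h : AgreeObs m m') (c : Cmd V) :
    AgreeObs (c.nextMem T m) (c.nextMem T m') := by
  intro x
  cases c with
  | skip => exact h x
  | assign v e =>
    have he := PTerm.eval_congr (T := T) h e
    rcases hc : e.testCall with _ | ⟨y, A⟩ <;>
      by_cases hx : x = v <;>
      simp [Cmd.nextMem, Cmd.next, hc, he, h x, hx]

theorem AgreeObs.memAfter {m m' : Mem V} (h : AgreeObs m m') (cs : List (Cmd V)) :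
    AgreeObs (memAfter T cs m) (memAfter T cs m') := by
  induction cs generalizing m m' with
  | nil => exact h
  | cons c cs ih => exact ih (h.nextMem c)

theorem State.observe_eq_iff {s s' : State V} :
    s.observe = s'.observe ↔ AgreeObs s.mem s'.mem ∧ s.act = s'.act ∧ s.hist = s'.hist := by
  constructor
  · intro h
    exact ⟨fun v => congrFun (congrArg (fun t : State V => t.mem) h) (.obs v),
      State.mk.inj h |>.2.1, State.mk.inj h |>.2.2⟩
  · rintro ⟨h, ha, hh⟩
    simp only [State.observe, State.mk.injEq, ha, hh, and_true]
    funext x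
    cases x with
    | obs v => exact h v
    | hist y A => rfl
    | par x => rfl

theorem World.observe_cur (w : World V) : w.observe.cur = w.cur.observe := by
  cases w <;> rfl

theorem World.agreeObs_of_observe_eq {w w' : World V} (h : w.observe = w'.observe) :
    AgreeObs w.cur.mem w'.cur.mem := by
  have := congrArg World.cur h
  rw [World.observe_cur, World.observe_cur] at this
  exact (State.observe_eq_iff.1 this).1

/-- Even the update of the test history is determined by the observation, since the dataset tested
is the value of an observable variable. -/
theorem Cmd.next_observe {s s' : State V} (h : s.observe = s'.observe) (c : Cmd V) :
    (c.next T s).observe = (c.next T s').observe := by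
  obtain ⟨hm, -, hh⟩ := State.observe_eq_iff.1 h
  refine State.observe_eq_iff.2 ⟨?_, by rw [Cmd.next_act, Cmd.next_act], ?_⟩
  · rw [Cmd.next_mem, Cmd.next_mem]
    exact hm.nextMem c
  · cases c with
    | skip => exact hh
    | assign v e =>
      rcases hc : e.testCall with _ | ⟨y, A⟩
      · simp [Cmd.next, hc, hh]
      · simp only [Cmd.next, hc, hh]
        rw [hm y]

theorem execList_observe {w w' : World V} (h : w.observe = w'.observe) (cs : List (Cmd V)) :
    (execList T cs w).observe = (execList T cs w').observe := by
  induction cs generalizing w w' with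
  | nil => exact h
  | cons c cs ih =>
    refine ih ?_
    have hc := congrArg World.cur h
    rw [World.observe_cur, World.observe_cur] at hc
    simp only [Cmd.exec, World.observe, h, Cmd.next_observe hc]

/-- A world of a model that looks like the outcome of executing some commands is the outcome of
executing them in a world of the model. -/
theorem Model.exists_execList_eq (M : Model T) (cs : List (Cmd V)) {w w' : World V}
    (hw' : w' ∈ M.worlds) (h : (execList T cs w).observe = w'.observe) :
    ∃ w₀ ∈ M.worlds, w' = execList T cs w₀ ∧ w.observe = w₀.observe := by
  induction cs generalizing w with
  | nil => exact ⟨w', hw', rfl, h⟩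
  | cons c cs ih =>
    obtain ⟨w₁, hw₁, rfl, h₁⟩ := ih h
    cases w₁ with
    | start s => cases h₁
    | snoc w₀ s =>
      simp only [Cmd.exec, World.observe, World.snoc.injEq] at h₁
      -- The observation reveals the last action, and the transition condition of the model then
      -- forces `s` to be the effect of `c`.
      have hact : s.act = .cmd c := by
        rw [← (State.observe_eq_iff.1 h₁.2).2.1, Cmd.next_act]
      have ht := M.trans _ _ hw₁
      rw [hact] at ht
      refine ⟨w₀, M.prefix_mem _ _ hw₁, ?_, h₁.1⟩
      rw [execList, Cmd.exec, ← show s = c.next T w₀.cur from ht]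

/-! ## Substitution -/

/-- The substitution `σ` describes the effect of the commands on the memories that agree with `m` on
the observable variables. -/
def Describes (T : Tests V) (σ : Var V → ATerm V) (cs : List (Cmd V)) (m : Mem V) : Prop :=
  ∀ m', AgreeObs m m' → ∀ I x, (σ x).eval T I m' = memAfter T cs m' x

theorem ATerm.eval_subst {σ : Var V → ATerm V} {I : V.IVar → List ℤ} {m m' : Mem V}
    (h : ∀ x, (σ x).eval T I m = m' x) (u : ATerm V) :
    (u.subst σ).eval T I m = u.eval T I m' := by
  induction u with
  | var x => exact h x
  | ivar i => rfl
  | app f args ih => simp only [ATerm.subst, ATerm.eval, ih]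
  | pval A u ih => simp only [ATerm.subst, ATerm.eval, ih]

theorem Atom.sat_subst {σ : Var V → ATerm V} {I : V.IVar → List ℤ} {cs : List (Cmd V)}
    {w : World V} (h : Describes T σ cs w.cur.mem) (a : Atom V) :
    (a.subst σ).Sat T I w ↔ a.Sat T I (execList T cs w) := by
  have hu := ATerm.eval_subst (T := T) (I := I) (h _ (fun _ => rfl) I)
  cases a <;>
    simp only [Atom.subst, Atom.Sat, hu, execList_cur_mem, hasSampled_execList]

/-- In the case of knowledge, executing `cs` maps the worlds indistinguishable from `w` onto those
indistinguishable from the outcome. The induction hypothesis applies to each of them because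
`Describes` covers every memory with the same observable part. -/
theorem MForm.sat_subst (M : Model T) {σ : Var V → ATerm V} {I : V.IVar → List ℤ}
    {cs : List (Cmd V)} (φ : MForm V) {w : World V} (h : Describes T σ cs w.cur.mem) :
    (φ.subst σ).Sat M I w ↔ φ.Sat M I (execList T cs w) := by
  induction φ generalizing w with
  | atom a => exact Atom.sat_subst h a
  | neg φ ih => exact not_congr (ih h)
  | and φ ψ ih₁ ih₂ => exact and_congr (ih₁ h) (ih₂ h)
  | know φ ih =>
    have key : ∀ w₀ : World V, w.observe = w₀.observe → Describes T σ cs w₀.cur.mem := fun w₀ h₀ m' hm' =>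
      h m' fun v => (World.agreeObs_of_observe_eq h₀ v).trans (hm' v)
    constructor
    · intro hk w' hw' ho
      obtain ⟨w₀, hw₀, rfl, h₀⟩ := M.exists_execList_eq cs hw' ho
      exact (ih (key w₀ h₀)).1 (hk w₀ hw₀ h₀)
    · intro hk w₀ hw₀ h₀
      exact (ih (key w₀ h₀)).2
        (hk _ (execList_mem_worlds M cs hw₀) (execList_observe h₀ cs))

/-- The quantifier causes no trouble because `Describes` holds for all interpretations of the
integer variables at once. -/
theorem Form.sat_subst (M : Model T) {σ : Var V → ATerm V} {cs : List (Cmd V)} (φ : Form V)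
    {I : V.IVar → List ℤ} {w : World V} (h : Describes T σ cs w.cur.mem) :
    (φ.subst σ).Sat M I w ↔ φ.Sat M I (execList T cs w) := by
  induction φ generalizing I with
  | base φ => exact MForm.sat_subst M φ h
  | neg φ ih => exact not_congr ih
  | and φ ψ ih₁ ih₂ => exact and_congr ih₁ ih₂
  | all i φ ih => exact forall_congr' fun n => ih

theorem PTerm.eval_toATerm (I : V.IVar → List ℤ) (m : Mem V) (e : PTerm V) :
    e.toATerm.eval T I m = e.eval T m := by
  induction e with
  | var v => rfl
  | app f args ih => simp only [PTerm.toATerm, ATerm.eval, PTerm.eval, ih]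
  | pval A e ih => simp only [PTerm.toATerm, ATerm.eval, PTerm.eval, ih]

theorem PTerm.sat_toForm (M : Model T) {I : V.IVar → List ℤ} {w : World V} (e : PTerm V) :
    e.toForm.Sat M I w ↔ e.eval T w.cur.mem = some (Value.bool true) := by
  simp [PTerm.toForm, Form.Sat, MForm.Sat, Atom.Sat, PTerm.eval_toATerm, ATerm.eval, Fun.tt]

theorem Form.sat_imp (M : Model T) {I : V.IVar → List ℤ} {w : World V} {φ ψ : Form V} :
    (φ.imp ψ).Sat M I w ↔ (φ.Sat M I w → ψ.Sat M I w) := by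
  rw [Form.imp, Form.Sat, Form.Sat, Form.Sat, not_and_not_right]

theorem describes_var_nil (m : Mem V) : Describes T ATerm.var [] m := fun _ _ _ _ => rfl

theorem describes_var_skip (m : Mem V) : Describes T ATerm.var [.skip] m := fun _ _ _ _ => rfl

theorem describes_assignSubst {v : V.Obs} {e : PTerm V} (he : e.testCall = none) (m : Mem V) :
    Describes T (assignSubst v e) [.assign v e] m := by
  intro m' _ I x
  by_cases hx : x = .obs v
  · subst hx
    simp [assignSubst, memAfter, Cmd.nextMem, Cmd.next, he, PTerm.eval_toATerm]
  · simp [assignSubst, memAfter, Cmd.nextMem, Cmd.next, he, hx, ATerm.eval]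

theorem describes_testSubst (v y : V.Obs) (A : V.Test) (m : Mem V) :
    Describes T (testSubst v y A) [.assign v (.pval A (.var y))] m := by
  intro m' _ I x
  by_cases hx : x = .hist y A
  · subst hx
    simp [testSubst, memAfter, Cmd.nextMem, Cmd.next, PTerm.testCall, ATerm.eval, Fun.succ]
  · by_cases hv : x = .obs v
    · subst hv
      simp [testSubst, assignSubst, memAfter, Cmd.nextMem, Cmd.next, PTerm.testCall,
        PTerm.eval_toATerm]
    · simp [testSubst, assignSubst, memAfter, Cmd.nextMem, Cmd.next, PTerm.testCall, hx, hv,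
        ATerm.eval]

/-! ## Typing -/

/-- The memory respects the type information of the environment. -/
def Env.RespectsMem (Γ : Env V) (m : Mem V) : Prop := ∀ x : Var V, HasTy (m x) (Γ.ty x)

theorem HypTest.pVal_hasTy (A : HypTest V) {o : Option Value} (h : HasTy o A.dataTy) :
    HasTy (A.pVal o) .prob := by
  obtain ⟨x, rfl, -⟩ := h
  refine ⟨A.pValue x, ?_, ENNReal.toReal_nonneg, ?_⟩
  · simp only [HypTest.pVal, dif_pos]
    rfl
  · exact ENNReal.toReal_le_of_le_ofReal zero_le_one (by simpa using prob_le_one)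

theorem PTerm.Typed.hasTy {e : PTerm V} {a : Ty} (h : e.Typed T Γ a) {m : Mem V}
    (hm : Γ.RespectsMem m) : HasTy (e.eval T m) a := by
  induction h with
  | var v => exact hm (.obs v)
  | app f args _ ih => exact f.typed _ ih
  | pval _ ih => exact (T _).pVal_hasTy ih

theorem PTerm.Typed.eval_bool {e : PTerm V} (h : e.Typed T Γ .bool) {m : Mem V}
    (hm : Γ.RespectsMem m) :
    e.eval T m = some (Value.bool true) ∨ e.eval T m = some (Value.bool false) := by
  obtain ⟨b, hb, -⟩ := h.hasTy hm
  cases (b : Bool)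
  · exact .inr hb
  · exact .inl hb

theorem Env.RespectsMem.nextMem {m : Mem V} (hm : Γ.RespectsMem m) {c : Cmd V}
    (hc : (Prog.cmd c).WellTyped T Γ) : Γ.RespectsMem (c.nextMem T m) := by
  classical
  cases c with
  | skip => exact hm
  | assign v e =>
    have hup : Γ.RespectsMem (Function.update m (.obs v) (e.eval T m)) := by
      intro x
      by_cases hx : x = .obs v
      · subst hx
        rw [Function.update_self]
        exact PTerm.Typed.hasTy hc hm
      · simpa [hx] using hm x
    rcases h : e.testCall with _ | ⟨y, A⟩
    · convert hup
      simp [Cmd.nextMem, Cmd.next, h]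
    · intro x
      by_cases hx : x = .hist y A
      · subst hx
        have hs : HasTy (succVal (m (.hist y A))) .nat :=
          Fun.succ.typed (fun _ => m (.hist y A)) (fun _ => hm (.hist y A))
        change HasTy _ .nat
        convert hs using 1
        simp [Cmd.nextMem, Cmd.next, h]
      · convert hup x using 1
        simp [Cmd.nextMem, Cmd.next, h, hx]

/-! ## Sequential runs of programs -/

/-- `Runs T C m cs`: started in the memory `m`, the program `C`, with parallel compositions executed
from left to right, terminates after executing the commands `cs`. -/
inductive Runs (T : Tests V) : Prog V → Mem V → List (Cmd V) → Prop
  | cmd (c m) : Runs T (.cmd c) m [c]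
  | seq {C₁ C₂ m cs ds} : Runs T C₁ m cs → Runs T C₂ (memAfter T cs m) ds →
      Runs T (.seq C₁ C₂) m (cs ++ ds)
  | par {C₁ C₂ m cs ds} : Runs T C₁ m cs → Runs T C₂ (memAfter T cs m) ds →
      Runs T (.par C₁ C₂) m (cs ++ ds)
  | ite_true {e C₁ C₂ m cs} : e.eval T m = some (Value.bool true) → Runs T C₁ m cs →
      Runs T (.ite e C₁ C₂) m cs
  | ite_false {e C₁ C₂ m cs} : e.eval T m = some (Value.bool false) → Runs T C₂ m cs →
      Runs T (.ite e C₁ C₂) m cs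
  | loop_true {e C m cs ds} : e.eval T m = some (Value.bool true) → Runs T C m cs →
      Runs T (.loop e C) (memAfter T cs m) ds → Runs T (.loop e C) m (cs ++ ds)
  | loop_false {e C m} : e.eval T m = some (Value.bool false) → Runs T (.loop e C) m []

theorem Value.bool_true_ne_false : some (Value.bool true) ≠ some (Value.bool false) := by
  intro h
  have h' : (true : Bool) = false := eq_of_heq (Sigma.mk.inj (Option.some.inj h)).2
  exact Bool.noConfusion h'

/-- With the scheduling fixed, only guards select a rule, and a guard cannot be both true and false.
The trace is thus a partial function of the memory. -/
theorem Runs.unique {C : Prog V} {m : Mem V} {cs cs' : List (Cmd V)} (h : Runs T C m cs)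
    (h' : Runs T C m cs') : cs = cs' := by
  induction h generalizing cs' with
  | cmd c m => cases h'; rfl
  | seq _ _ ih₁ ih₂ =>
    cases h' with | seq h₁ h₂ => obtain rfl := ih₁ h₁; rw [ih₂ h₂]
  | par _ _ ih₁ ih₂ =>
    cases h' with | par h₁ h₂ => obtain rfl := ih₁ h₁; rw [ih₂ h₂]
  | ite_true he _ ih =>
    cases h' with
    | ite_true _ h => exact ih h
    | ite_false hf _ => exact absurd (he.symm.trans hf) Value.bool_true_ne_false
  | ite_false he _ ih =>
    cases h' with
    | ite_true ht _ => exact absurd (ht.symm.trans he) Value.bool_true_ne_false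
    | ite_false _ h => exact ih h
  | loop_true he _ _ ih₁ ih₂ =>
    cases h' with
    | loop_true _ h₁ h₂ => obtain rfl := ih₁ h₁; rw [ih₂ h₂]
    | loop_false hf => exact absurd (he.symm.trans hf) Value.bool_true_ne_false
  | loop_false he =>
    cases h' with
    | loop_true ht _ _ => exact absurd (ht.symm.trans he) Value.bool_true_ne_false
    | loop_false _ => rfl

theorem Runs.congr {C : Prog V} {m m' : Mem V} {cs : List (Cmd V)} (h : Runs T C m cs)
    (hm : AgreeObs m m') : Runs T C m' cs := by
  induction h generalizing m' with
  | cmd c m => exact .cmd c m'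
  | seq _ _ ih₁ ih₂ => exact .seq (ih₁ hm) (ih₂ (hm.memAfter _))
  | par _ _ ih₁ ih₂ => exact .par (ih₁ hm) (ih₂ (hm.memAfter _))
  | ite_true he _ ih => exact .ite_true ((PTerm.eval_congr hm _).symm.trans he) (ih hm)
  | ite_false he _ ih => exact .ite_false ((PTerm.eval_congr hm _).symm.trans he) (ih hm)
  | loop_true he _ _ ih₁ ih₂ =>
    exact .loop_true ((PTerm.eval_congr hm _).symm.trans he) (ih₁ hm) (ih₂ (hm.memAfter _))
  | loop_false he => exact .loop_false ((PTerm.eval_congr hm _).symm.trans he)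

/-- This provides the typing that is required of a function symbol denoting the final value of a
variable. -/
theorem Runs.respectsMem {C : Prog V} {m : Mem V} {cs : List (Cmd V)} (h : Runs T C m cs)
    (hC : C.WellTyped T Γ) (hm : Γ.RespectsMem m) : Γ.RespectsMem (memAfter T cs m) := by
  induction h with
  | cmd c m => exact hm.nextMem hC
  | seq _ _ ih₁ ih₂ => rw [memAfter_append]; exact ih₂ hC.2 (ih₁ hC.1 hm)
  | par _ _ ih₁ ih₂ => rw [memAfter_append]; exact ih₂ hC.2 (ih₁ hC.1 hm)
  | ite_true _ _ ih => exact ih hC.2.1 hm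
  | ite_false _ _ ih => exact ih hC.2.2 hm
  | loop_true _ _ _ ih₁ ih₂ => rw [memAfter_append]; exact ih₂ hC (ih₁ hC.2 hm)
  | loop_false _ => exact hm

/-- The executions of a component, lifted to a context that continues with `D`. -/
theorem steps_lift {F : Prog V → Prog V} {D : Prog V}
    (hrun : ∀ {C C' w w'}, Step T (.run C w) (.run C' w') → Step T (.run (F C) w) (.run (F C') w'))
    (hdone : ∀ {C w w'}, Step T (.run C w) (.done w') → Step T (.run (F C) w) (.run D w'))
    {C : Prog V} {w w' : World V} (h : Relation.ReflTransGen (Step T) (.run C w) (.done w')) :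
    Relation.ReflTransGen (Step T) (.run (F C) w) (.run D w') := by
  generalize hc : Config.run C w = c at h
  induction h using Relation.ReflTransGen.head_induction_on generalizing C w with
  | refl => cases hc
  | @head a b hab hb ih =>
    subst hc
    cases b with
    | run C₁ w₁ => exact .head (hrun hab) (ih rfl)
    | done w₁ =>
      -- A final configuration has no successor, so the remaining execution is empty.
      have : w₁ = w' := by
        rcases Relation.ReflTransGen.cases_head hb with h | ⟨d, hd, -⟩
        · exact Config.done.inj h
        · cases hd
      exact this ▸ .single (hdone hab)

theorem Runs.mem_sem {C : Prog V} {m : Mem V} {cs : List (Cmd V)} (h : Runs T C m cs)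
    {w : World V} (hw : w.cur.mem = m) : execList T cs w ∈ C.sem T w := by
  induction h generalizing w with
  | cmd c m => exact .single (.cmd c w)
  | seq _ _ ih₁ ih₂ =>
    rw [execList_append]
    exact (steps_lift (Step.seq_run _) (Step.seq_done _) (ih₁ hw)).trans
      (ih₂ (by rw [execList_cur_mem, hw]))
  | @par C₁ C₂ m cs ds _ _ ih₁ ih₂ =>
    rw [execList_append]
    exact (steps_lift (F := fun C => .par C C₂) (Step.par_left_run _) (Step.par_left_done _)
      (ih₁ hw)).trans (ih₂ (by rw [execList_cur_mem, hw]))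
  | ite_true he _ ih => exact .head (.ite_true _ _ (hw ▸ he)) (ih hw)
  | ite_false he _ ih => exact .head (.ite_false _ _ (hw ▸ he)) (ih hw)
  | loop_true he _ _ ih₁ ih₂ =>
    rw [execList_append]
    exact .head (.loop_true _ (hw ▸ he))
      ((steps_lift (Step.seq_run _) (Step.seq_done _) (ih₁ hw)).trans
        (ih₂ (by rw [execList_cur_mem, hw])))
  | loop_false he => exact .single (.loop_false _ (hw ▸ he))

/-! ## Weakest preconditions -/

/-- Function symbols have finite arity; finiteness lets one of them take the whole memory as its
arguments. -/
instance Var.finite : Finite (Var V) := by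
  have := V.finObs
  have := V.finPar
  have := V.finTest
  refine Finite.of_injective
    (β := V.Obs ⊕ (V.Obs × V.Test) ⊕ V.Par)
    (fun | .obs v => .inl v | .hist y A => .inr (.inl (y, A)) | .par x => .inr (.inr x)) ?_
  rintro (a | ⟨a, b⟩ | a) (c | ⟨c, d⟩ | c) h <;> simp_all

/-- Every function on memories that maps well-typed memories to values of some type is denoted by a
term. -/
theorem Env.exists_term (T : Tests V) (Γ : Env V) (a : Ty) (f : Mem V → Option Value)
    (hf : ∀ m, Γ.RespectsMem m → HasTy (f m) a) :
    ∃ u : ATerm V, ∀ I m, u.eval T I m = f m := by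
  obtain ⟨n, ⟨e⟩⟩ := Finite.exists_equiv_fin (Var V)
  -- Typing constrains `F` only on memories that respect `Γ`, yet its value is `f` on all memories.
  let F : Fun :=
    { arity := n
      dom := fun i => Γ.ty (e.symm i)
      cod := a
      fn := fun b => f fun x => b (e x)
      typed := fun b hb => hf _ fun x => by simpa using hb (e x) }
  refine ⟨.app F fun i => .var (e.symm i), fun I m => ?_⟩
  simp [ATerm.eval, F]

/-- Expressibility of the weakest preconditions of sequential runs. -/
theorem Env.exists_wp {C : Prog V} (hC : C.WellTyped T Γ) (φ : Form V) :
    ∃ χ : Form V, ∀ (M : Model T) (I : V.IVar → List ℤ) (w : World V),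
      χ.Sat M I w ↔ ∀ cs, Runs T C w.cur.mem cs → φ.Sat M I (execList T cs w) := by
  classical
  -- The trace as a total function; the default `[]` for divergence leaves the memory, hence its
  -- types, unchanged.
  let tr : Mem V → List (Cmd V) := fun m => if h : ∃ cs, Runs T C m cs then h.choose else []
  have htr : ∀ {m cs}, Runs T C m cs → tr m = cs := fun {m cs} h => by
    have h' : ∃ cs, Runs T C m cs := ⟨cs, h⟩
    simp only [tr, dif_pos h']
    exact h'.choose_spec.unique h
  have hty : ∀ m, Γ.RespectsMem m → Γ.RespectsMem (memAfter T (tr m) m) := fun m hm => by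
    by_cases h : ∃ cs, Runs T C m cs
    · obtain ⟨cs, h⟩ := h
      rw [htr h]
      exact h.respectsMem hC hm
    · have : tr m = [] := dif_neg h
      rw [this]
      exact hm
  choose σ hσ using fun x => Γ.exists_term T (Γ.ty x) (fun m => memAfter T (tr m) m x)
    fun m hm => hty m hm x
  obtain ⟨t, ht⟩ := Γ.exists_term T .bool
    (fun m => some (Value.bool (decide (∃ cs, Runs T C m cs)))) fun m _ => ⟨_, rfl, trivial⟩
  refine ⟨.imp (.base (.atom (.eq t (.app Fun.tt Fin.elim0)))) (φ.subst σ), fun M I w => ?_⟩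
  have hterm : (Form.base (.atom (.eq t (.app Fun.tt Fin.elim0)))).Sat M I w ↔
      ∃ cs, Runs T C w.cur.mem cs := by
    by_cases h : ∃ cs, Runs T C w.cur.mem cs
    · simp [Form.Sat, MForm.Sat, Atom.Sat, ht, ATerm.eval, Fun.tt, h]
    · simpa [Form.Sat, MForm.Sat, Atom.Sat, ht, ATerm.eval, Fun.tt, h] using
        fun h' => Value.bool_true_ne_false (congrArg some h')
  -- The terms `σ` compute the trace afresh in each memory, but memories with the same observable
  -- part yield the same `cs`, as `Describes` demands.
  have hsub : ∀ cs, Runs T C w.cur.mem cs →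
      ((φ.subst σ).Sat M I w ↔ φ.Sat M I (execList T cs w)) := fun cs h =>
    φ.sat_subst M fun m' hm' I x => by rw [hσ, htr (h.congr hm')]
  rw [Form.sat_imp, hterm]
  exact ⟨fun h cs hcs => (hsub cs hcs).1 (h ⟨cs, hcs⟩),
    fun h ⟨cs, hcs⟩ => (hsub cs hcs).2 (h cs hcs)⟩

/-! ## Completeness -/

theorem Env.entails_imp {ψ χ : Form V}
    (h : ∀ (M : Model T) I, ∀ w ∈ M.worlds, Γ.Respects w → ψ.Sat M I w → χ.Sat M I w) :
    Γ.Entails T (ψ.imp χ) := by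
  exact fun M I w hw hr => (Form.sat_imp M).2 (h M I w hw hr)

theorem PTerm.Typed.pval_var_inv {A : V.Test} {y : V.Obs} {a : Ty}
    (h : PTerm.Typed T Γ (.pval A (.var y)) a) : Γ.obs y = (T A).dataTy ∧ a = .prob := by
  cases h with
  | pval h =>
    refine ⟨?_, rfl⟩
    generalize (T A).dataTy = b at h
    cases h
    rfl

theorem PTerm.eq_of_testCall {e : PTerm V} {y : V.Obs} {A : V.Test}
    (h : e.testCall = some (y, A)) : e = .pval A (.var y) := by
  unfold PTerm.testCall at h
  split at h <;> simp_all

/-- The judgment is valid for the sequential runs of the program. -/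
def SeqValid (T : Tests V) (Γ : Env V) (ψ : Form V) (C : Prog V) (φ : Form V) : Prop :=
  ∀ (M : Model T) (I : V.IVar → List ℤ), ∀ w ∈ M.worlds, Γ.Respects w → ψ.Sat M I w →
    ∀ cs, Runs T C w.cur.mem cs → φ.Sat M I (execList T cs w)

/-- A judgment that is valid for a command `c` described by `σ` follows from the judgment whose
precondition is the substitution instance of the postcondition. -/
theorem SeqValid.derivable_of_describes {ψ φ : Form V} {c : Cmd V} {σ : Var V → ATerm V}
    (h : SeqValid T Γ ψ (.cmd c) φ) (hσ : ∀ m, Describes T σ [c] m)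
    (hd : Derivable T Γ (φ.subst σ) (.cmd c) φ) : Derivable T Γ ψ (.cmd c) φ :=
  .conseq (Env.entails_imp fun M I w hw hr hψ =>
      (φ.sat_subst M (hσ _)).2 (h M I w hw hr hψ [c] (.cmd c _))) hd
    (Env.entails_imp fun _ _ _ _ _ => id)

/-- The intermediate assertion is the weakest precondition of `C₂`. Stated separately because
parallel composition reduces to it as well. -/
theorem SeqValid.derivable_comp {ψ φ : Form V} {C₁ C₂ : Prog V}
    (hC₂ : C₂.WellTyped T Γ)
    (ih₁ : ∀ {ψ φ}, SeqValid T Γ ψ C₁ φ → Derivable T Γ ψ C₁ φ)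
    (ih₂ : ∀ {ψ φ}, SeqValid T Γ ψ C₂ φ → Derivable T Γ ψ C₂ φ)
    (h : SeqValid T Γ ψ (.seq C₁ C₂) φ) : Derivable T Γ ψ (.seq C₁ C₂) φ := by
  obtain ⟨χ, hχ⟩ := Env.exists_wp hC₂ φ
  refine .seq (χ := χ) (ih₁ fun M I w hw hr hψ cs hcs => (hχ _ _ _).2 fun ds hds => ?_)
    (ih₂ fun M I w _ _ hw => (hχ M I w).1 hw)
  rw [execList_cur_mem] at hds
  rw [← execList_append]
  exact h M I w hw hr hψ _ (.seq hcs hds)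

theorem SeqValid.derivable {C : Prog V} (hwf : C.WellFormed) (hC : C.WellTyped T Γ)
    {ψ φ : Form V} (h : SeqValid T Γ ψ C φ) : Derivable T Γ ψ C φ := by
  induction C generalizing ψ φ with
  | cmd c =>
    cases c with
    | skip =>
      -- Executing `skip` lengthens the world, so invariance of `φ` needs an argument: the identity
      -- substitution describes both `[.skip]` and `[]`.
      exact .conseq (Env.entails_imp fun M I w hw hr hψ =>
          (φ.sat_subst M (describes_var_skip _)).2 (h M I w hw hr hψ _ (.cmd .skip _)))
        (.skip (φ.subst ATerm.var))
        (Env.entails_imp fun M I w _ _ => (φ.sat_subst M (describes_var_nil _)).1)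
    | assign v e =>
      rcases he : e.testCall with _ | ⟨y, A⟩
      · exact h.derivable_of_describes (describes_assignSubst he) (.updVar φ he hC)
      · obtain rfl := PTerm.eq_of_testCall he
        obtain ⟨hy, hv⟩ := PTerm.Typed.pval_var_inv hC
        exact h.derivable_of_describes (describes_testSubst v y A) (.hist φ hy hv)
  | seq C₁ C₂ ih₁ ih₂ =>
    exact SeqValid.derivable_comp hC.2 (ih₁ hwf.1 hC.1) (ih₂ hwf.2 hC.2) h
  | par C₁ C₂ ih₁ ih₂ =>
    refine .par hwf.1 (SeqValid.derivable_comp hC.2 (ih₁ hwf.2.1 hC.1) (ih₂ hwf.2.2 hC.2) ?_)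
    intro M I w hw hr hψ _ hcs
    cases hcs with
    | seq h₁ h₂ => exact h M I w hw hr hψ _ (.par h₁ h₂)
  | ite e C₁ C₂ ih₁ ih₂ =>
    refine .ite (ih₁ hwf.1 hC.2.1 ?_) (ih₂ hwf.2 hC.2.2 ?_)
    · rintro M I w hw hr ⟨hψ, he⟩ cs hcs
      exact h M I w hw hr hψ cs (.ite_true ((PTerm.sat_toForm M e).1 he) hcs)
    · rintro M I w hw hr ⟨hψ, he⟩ cs hcs
      -- The negated guard only says "not `true`"; well-typedness excludes undefined and other
      -- values, leaving `false`.
      exact h M I w hw hr hψ cs (.ite_false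
        ((hC.1.eval_bool hr).resolve_left fun ht => he ((PTerm.sat_toForm M e).2 ht)) hcs)
  | loop e C ih =>
    -- The invariant is the weakest precondition of the loop itself: one more iteration followed by
    -- a run of the loop is again a run of the loop, and on exit the run is empty, so the invariant
    -- gives `φ`.
    obtain ⟨χ, hχ⟩ := Env.exists_wp (C := .loop e C) hC φ
    refine .conseq (Env.entails_imp fun M I w hw hr hψ => (hχ M I w).2 (h M I w hw hr hψ))
      (.loop (ψ := χ) (ih hwf hC.2 ?_)) (Env.entails_imp ?_)
    · rintro M I w hw hr ⟨hx, he⟩ _ hcs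
      refine (hχ _ _ _).2 fun ds hds => ?_
      rw [execList_cur_mem] at hds
      rw [← execList_append]
      exact (hχ M I w).1 hx _ (.loop_true ((PTerm.sat_toForm M e).1 he) hcs hds)
    · rintro M I w hw hr ⟨hx, he⟩
      exact (hχ M I w).1 hx [] (.loop_false
        ((hC.1.eval_bool hr).resolve_left fun ht => he ((PTerm.sat_toForm M e).2 ht)))

end BHL

/-- Relative completeness of belief Hoare logic: every valid judgment about a (well-formed and
well-typed) program is derivable. -/
theorem mainTheorem2 {V : BHL.Vocab} (T : BHL.Tests V) (Γ : BHL.Env V)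
    (ψ : BHL.Form V) (C : BHL.Prog V) (φ : BHL.Form V)
    (hwf : C.WellFormed) (hty : C.WellTyped T Γ)
    (hvalid : BHL.Valid T Γ ψ C φ) :
    BHL.Derivable T Γ ψ C φ :=
  BHL.SeqValid.derivable hwf hty fun M I w hw hr hψ _ hcs =>
    hvalid M I w hw hr hψ _ (hcs.mem_sem rfl)
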